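/- Let $r,c$ be positive integers, let $\bm p=(p_{ij})$ be a probability vector on the cells of an $r\times c$ table, and let $\bm n=(n_{ij})$ be multinomial with sample size $n$ and cell probabilities $\bm p$. For a real number $\alpha$ put $\hat p^{(\alpha)}_{ij}=\dfrac{n_{ij}+\alpha}{n+rc\,\alpha}$; for $\alpha>0$ this is the posterior mean of $p_{ij}$ under the symmetric Dirichlet prior with parameter $\alpha$, and for $\alpha=0$ it is the sample proportion. Let $f$ be a real function that is four times differentiable at $\bm p$, let $\mathrm{MSE}_n(\alpha)=\mathrm E\big[(f(\hat{\bm p}^{(\alpha)})-f(\bm p))^2\big]$, and let $S\subseteq\mathbb R$ be the set of Dirichlet parameters under consideration (for example $S=(0,\infty)$). Assume that for every $\alpha\in S$ the values of $f$ at the possible estimates grow subexponentially, i.e. for every $\varepsilon>0$ and all large $n$, $|f(\hat{\bm p}^{(\alpha)})|\le e^{\varepsilon n}$ for every table of counts with total $n$ (for $S\subseteq[0,\infty)$ this holds if $f$ is bounded on the probability simplex). With $\bm g=\partial f(\bm p)/\partial\bm p$, $H=\partial^2 f(\bm p)/\partial\bm p\,\partial\bm p^\top$, $\bm d=rc\,\bm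 p-\bm 1_{rc}$ and $\Sigma=\mathrm{diag}(\bm p)-\bm p\bm p^\top$, let $$A_1=\mathrm{tr}\big[\bm g\bm g^\top\bm d\bm d^\top\big],\qquad A_2=\tfrac12\,\bm d^\top\bm g\;\mathrm{tr}[H\Sigma]+rc\,\mathrm{tr}\big[\bm g\bm g^\top\Sigma\big]+\mathrm{tr}\big[\bm g\bm d^\top H\Sigma\big].$$ Suppose that $A_1>0$ and that $\alpha^*=A_2/A_1$ belongs to $S$. Then $\alpha^*$ is the Dirichlet parameter in $S$ that asymptotically minimises the MSE of the plug-in estimator $f(\hat{\bm p}^{(\alpha)})$, in the following sense. (i) There are numbers $C_n$ independent of $\alpha$ such that $\lim_{n\to\infty}n^2\,(\mathrm{MSE}_n(\alpha)-C_n)=A_1\alpha^2-2A_2\alpha$ for every $\alpha\in S$. (ii) For every sequence $C_n$ independent of $\alpha$ for which the finite limit $L(\alpha)=\lim_{n\to\infty}n^2\,(\mathrm{MSE}_n(\alpha)-C_n)$ exists for all $\alpha\in S$, one has $\operatorname{argmin}_{\alpha\in S}L(\alpha)=\{A_2/A_1\}$. (iii) For every $\alpha\in S$ with $\alpha\ne\alpha^*$,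 $\mathrm{MSE}_n(\alpha^*)<\mathrm{MSE}_n(\alpha)$ for all sufficiently large $n$. -/

import Mathlib

open Filter Topology

noncomputable section

namespace ContingencyTable

/-- The cells `(i, j)` of an `r × c` contingency table. -/
abbrev Cell (r c : ℕ) : Type := Fin r × Fin c

variable {r c : ℕ}

/-- The multinomial probability `n! / ∏ n_ij! * ∏ p_ij ^ n_ij` of the table of counts `N`
(with `n = ∑ N_ij`). -/
def multinomialProb (p : Cell r c → ℝ) (N : Cell r c → ℕ) : ℝ :=
  (((∑ x, N x).factorial : ℝ) / ∏ x, ((N x).factorial : ℝ)) * ∏ x, p x ^ N x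

/-- The finite set of all tables of counts with total `n`. -/
def tables (r c n : ℕ) : Finset (Cell r c → ℕ) :=
  Finset.piAntidiag Finset.univ n

/-- The expectation of `g(N)` where the table `N` has the multinomial distribution with sample
size `n` and cell probabilities `p`. -/
def expectation (p : Cell r c → ℝ) (n : ℕ) (g : (Cell r c → ℕ) → ℝ) : ℝ :=
  ∑ N ∈ tables r c n, multinomialProb p N * g N

/-- The posterior mean `(n_ij + α) / (n + r c α)` of the cell probabilities under the symmetric
Dirichlet prior with parameter `α`, given the table `N` with total `n`; for `α = 0` it is the
table of sample proportions. -/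
def posteriorMean (α : ℝ) (n : ℕ) (N : Cell r c → ℕ) : Cell r c → ℝ :=
  fun x => ((N x : ℝ) + α) / ((n : ℝ) + (r : ℝ) * (c : ℝ) * α)

/-- The mean squared error `E[(f(p̂^(α)) - f(p))²]` at sample size `n`. -/
def mse (f : (Cell r c → ℝ) → ℝ) (p : Cell r c → ℝ) (n : ℕ) (α : ℝ) : ℝ :=
  expectation p n fun N => (f (posteriorMean α n N) - f p) ^ 2

/-- `f` is `m` times (Fréchet) differentiable at `p`: the derivatives of order below `m` exist in
a neighbourhood of `p`, and the one of order `m - 1` is differentiable at `p`. -/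
def TimesDifferentiableAt (m : ℕ) (f : (Cell r c → ℝ) → ℝ) (p : Cell r c → ℝ) : Prop :=
  (∀ k, k + 1 < m → ∀ᶠ x in 𝓝 p, DifferentiableAt ℝ (iteratedFDeriv ℝ k f) x) ∧
    ∀ k, k < m → DifferentiableAt ℝ (iteratedFDeriv ℝ k f) p

/-- The values of `f` at the estimates with parameter `α` grow subexponentially in the sample
size. If `f` is bounded on the probability simplex, this holds for every `α ≥ 0`. -/
def SubexponentialAlong (f : (Cell r c → ℝ) → ℝ) (α : ℝ) : Prop :=
  ∀ ε : ℝ, 0 < ε → ∀ᶠ n : ℕ in atTop, ∀ N ∈ tables r c n,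
    |f (posteriorMean α n N)| ≤ Real.exp (ε * n)

/-- The partial derivative `∂f/∂p_x` at `q`. -/
def partialDeriv (f : (Cell r c → ℝ) → ℝ) (x : Cell r c) (q : Cell r c → ℝ) : ℝ :=
  fderiv ℝ f q (Pi.single x 1)

/-- The gradient `∂f(p)/∂p`. -/
def grad (f : (Cell r c → ℝ) → ℝ) (p : Cell r c → ℝ) : Cell r c → ℝ :=
  fun x => partialDeriv f x p

/-- The Hessian matrix `∂²f(p)/∂p∂pᵀ`. -/
def hess (f : (Cell r c → ℝ) → ℝ) (p : Cell r c → ℝ) : Matrix (Cell r c) (Cell r c) ℝ :=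
  Matrix.of fun x y => partialDeriv (partialDeriv f y) x p

/-- The vector `r c p - 1`. -/
def shift (p : Cell r c → ℝ) : Cell r c → ℝ :=
  fun x => (r : ℝ) * (c : ℝ) * p x - 1

/-- The matrix `diag(p) - p pᵀ`. -/
def covMat (p : Cell r c → ℝ) : Matrix (Cell r c) (Cell r c) ℝ :=
  Matrix.diagonal p - Matrix.vecMulVec p p

/-- The coefficient `A₁`. -/
def A1 (f : (Cell r c → ℝ) → ℝ) (p : Cell r c → ℝ) : ℝ :=
  (Matrix.vecMulVec (grad f p) (grad f p) * Matrix.vecMulVec (shift p) (shift p)).trace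

/-- The coefficient `A₂`. -/
def A2 (f : (Cell r c → ℝ) → ℝ) (p : Cell r c → ℝ) : ℝ :=
  1 / 2 * (shift p ⬝ᵥ grad f p) * (hess f p * covMat p).trace
    + (r : ℝ) * (c : ℝ) * (Matrix.vecMulVec (grad f p) (grad f p) * covMat p).trace
    + (Matrix.vecMulVec (grad f p) (shift p) * hess f p * covMat p).trace

/-- `L α = lim n² (MSE_n(α) - C_n)` for all `α ∈ S`: the limit of the MSE, rescaled by `n²`, after
removal of a term `C_n` that does not depend on `α`. -/
def IsRescaledLimit (f : (Cell r c → ℝ) → ℝ) (p : Cell r c → ℝ) (S : Set ℝ)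
    (C : ℕ → ℝ) (L : ℝ → ℝ) : Prop :=
  ∀ α ∈ S, Tendsto (fun n : ℕ => (n : ℝ) ^ 2 * (mse f p n α - C n)) atTop (𝓝 (L α))

end ContingencyTable

end

noncomputable section

namespace ContingencyTable

variable {r c : ℕ}

/-! Everything follows from one limit, `tendsto_sq_mul_mse_sub`: `n² (MSE(α) - MSE(β))` tends to `A₁
(α² - β²) - 2 A₂ (α - β)`. With `β = α* = A₂ / A₁` this is `A₁ (α - α*)²`, and any `C_n` cancels
from such differences.

Put `u = N / n - p` and `K = rc`. The posterior mean is `p + u - b (K u + d)` with weight `b = α /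
(n + Kα)`, of order `1/n`. A difference of two squared errors therefore carries the factor `b - b'`,
and the cofactor is needed only up to `o(1/n)`. Hence a second order expansion of `f` suffices,
provided its remainder is controlled in increments (`exists_taylorRem_sub_le`), so that the factor
`b - b'` is not lost. The cofactor is minus `leadingTerm`, a quadratic polynomial in `u`, whose mean
`2 A₂ / n - (b + b') A₁` comes from the first two multinomial moments (`expectation_leadingTerm`).

The expansion holds only for small `u`. The other tables have exponentially small probability
(`exists_tail_bound`), which beats the subexponential growth of `f`. -/

lemma sum_of_mem_tables {n : ℕ} {N : Cell r c → ℕ} (hN : N ∈ tables r c n) : ∑ x, N x = n :=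
  (Finset.mem_piAntidiag.1 hN).1

lemma multinomialProb_nonneg {p : Cell r c → ℝ} (hp : ∀ x, 0 ≤ p x) (N : Cell r c → ℕ) :
    0 ≤ multinomialProb p N :=
  mul_nonneg (by positivity) (Finset.prod_nonneg fun x _ => pow_nonneg (hp x) _)

lemma multinomialProb_eq (p : Cell r c → ℝ) (N : Cell r c → ℕ) :
    multinomialProb p N = (Nat.multinomial Finset.univ N : ℝ) * ∏ x, p x ^ N x := by
  have h : (∏ x, ((N x).factorial : ℝ)) * (Nat.multinomial Finset.univ N : ℝ)
      = ((∑ x, N x).factorial : ℝ) := by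
    exact_mod_cast Nat.multinomial_spec Finset.univ N
  have h0 : (∏ x, ((N x).factorial : ℝ)) ≠ 0 :=
    Finset.prod_ne_zero_iff.2 fun x _ => by positivity
  rw [multinomialProb, ← h, mul_div_cancel_left₀ _ h0]

/-! ### Multinomial expectation as a positive linear functional -/

section linear

variable (p : Cell r c → ℝ) (n : ℕ)

lemma expectation_add (g h : (Cell r c → ℕ) → ℝ) :
    expectation p n (fun N => g N + h N) = expectation p n g + expectation p n h := by
  simp [expectation, mul_add, Finset.sum_add_distrib]

lemma expectation_sub (g h : (Cell r c → ℕ) → ℝ) :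
    expectation p n (fun N => g N - h N) = expectation p n g - expectation p n h := by
  simp [expectation, mul_sub, Finset.sum_sub_distrib]

lemma expectation_const_mul (a : ℝ) (g : (Cell r c → ℕ) → ℝ) :
    expectation p n (fun N => a * g N) = a * expectation p n g := by
  simp only [expectation, Finset.mul_sum]
  exact Finset.sum_congr rfl fun N _ => by ring

lemma expectation_sum {ι : Type*} (s : Finset ι) (g : ι → (Cell r c → ℕ) → ℝ) :
    expectation p n (fun N => ∑ i ∈ s, g i N) = ∑ i ∈ s, expectation p n (g i) := by
  simp only [expectation, Finset.mul_sum]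
  exact Finset.sum_comm

variable {p n}

lemma expectation_congr {g h : (Cell r c → ℕ) → ℝ} (H : ∀ N ∈ tables r c n, g N = h N) :
    expectation p n g = expectation p n h :=
  Finset.sum_congr rfl fun N hN => by rw [H N hN]

lemma expectation_mono (hp : ∀ x, 0 ≤ p x) {g h : (Cell r c → ℕ) → ℝ}
    (H : ∀ N ∈ tables r c n, g N ≤ h N) : expectation p n g ≤ expectation p n h :=
  Finset.sum_le_sum fun N hN => mul_le_mul_of_nonneg_left (H N hN) (multinomialProb_nonneg hp N)

lemma abs_expectation_le (hp : ∀ x, 0 ≤ p x) (g : (Cell r c → ℕ) → ℝ) :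
    |expectation p n g| ≤ expectation p n fun N => |g N| := by
  refine (Finset.abs_sum_le_sum_abs _ _).trans_eq (Finset.sum_congr rfl fun N _ => ?_)
  rw [abs_mul, abs_of_nonneg (multinomialProb_nonneg hp N)]

end linear

/-! ### Moments from the generating function -/

/-- The moment generating function of the multinomial distribution. -/
lemma expectation_exp (p : Cell r c → ℝ) (n : ℕ) (v : Cell r c → ℝ) :
    expectation p n (fun N => Real.exp (∑ x, v x * N x)) = (∑ x, p x * Real.exp (v x)) ^ n := by
  rw [Finset.sum_pow_eq_sum_piAntidiag]
  refine Finset.sum_congr rfl fun N _ => ?_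
  simp only [multinomialProb_eq, Real.exp_sum]
  rw [mul_assoc, ← Finset.prod_mul_distrib]
  congr 1
  refine Finset.prod_congr rfl fun x _ => ?_
  rw [mul_pow, ← Real.exp_nat_mul, mul_comm (v x)]

lemma expectation_one {p : Cell r c → ℝ} (hp : p ∈ stdSimplex ℝ (Cell r c)) (n : ℕ) :
    expectation p n (fun _ => 1) = 1 := by
  have := expectation_exp p n 0
  simpa [hp.2] using this

lemma expectation_const {p : Cell r c → ℝ} (hp : p ∈ stdSimplex ℝ (Cell r c)) (n : ℕ) (a : ℝ) :
    expectation p n (fun _ => a) = a := by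
  have := expectation_const_mul p n a (fun _ => 1)
  rw [expectation_one hp] at this
  simpa using this

/-- Differentiate the generating function at `v` in direction `w`. Keeping the exponential factor
allows a second differentiation, which gives the second moments. -/
lemma expectation_linear_mul_exp (p : Cell r c → ℝ) (n : ℕ) (v w : Cell r c → ℝ) :
    expectation p n (fun N => (∑ x, w x * N x) * Real.exp (∑ x, v x * N x)) =
      n * (∑ x, p x * Real.exp (v x)) ^ (n - 1) * ∑ x, p x * (w x * Real.exp (v x)) := by
  have h1 : HasDerivAt (fun s : ℝ => expectation p n
      fun N => Real.exp (∑ x, (v x + s * w x) * N x))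
      (expectation p n (fun N => (∑ x, w x * N x) * Real.exp (∑ x, v x * N x))) 0 := by
    refine HasDerivAt.fun_sum fun N _ => HasDerivAt.const_mul _ ?_
    have : HasDerivAt (fun s : ℝ => ∑ x, (v x + s * w x) * (N x : ℝ)) (∑ x, w x * N x) 0 := by
      refine HasDerivAt.fun_sum fun x _ => HasDerivAt.mul_const ?_ _
      simpa using ((hasDerivAt_id (0 : ℝ)).mul_const (w x)).const_add (v x)
    simpa [mul_comm] using this.exp
  have h2 : HasDerivAt (fun s : ℝ => (∑ x, p x * Real.exp (v x + s * w x)) ^ n)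
      (n * (∑ x, p x * Real.exp (v x)) ^ (n - 1) * ∑ x, p x * (w x * Real.exp (v x))) 0 := by
    have : HasDerivAt (fun s : ℝ => ∑ x, p x * Real.exp (v x + s * w x))
        (∑ x, p x * (w x * Real.exp (v x))) 0 := by
      refine HasDerivAt.fun_sum fun x _ => HasDerivAt.const_mul _ ?_
      have : HasDerivAt (fun s : ℝ => v x + s * w x) (w x) 0 := by
        simpa using ((hasDerivAt_id (0 : ℝ)).mul_const (w x)).const_add (v x)
      simpa [mul_comm] using this.exp
    simpa using this.fun_pow n
  simp only [expectation_exp] at h1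
  exact h1.unique h2

lemma expectation_linear {p : Cell r c → ℝ} (hp : p ∈ stdSimplex ℝ (Cell r c)) (n : ℕ)
    (w : Cell r c → ℝ) :
    expectation p n (fun N => ∑ x, w x * N x) = n * ∑ x, p x * w x := by
  simpa [hp.2] using expectation_linear_mul_exp p n 0 w

lemma expectation_linear_mul_linear {p : Cell r c → ℝ} (hp : p ∈ stdSimplex ℝ (Cell r c)) (n : ℕ)
    (v w : Cell r c → ℝ) :
    expectation p n (fun N => (∑ x, v x * N x) * ∑ x, w x * N x) =
      n * (n - 1) * (∑ x, p x * v x) * (∑ x, p x * w x) + n * ∑ x, p x * (v x * w x) := by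
  have h1 : HasDerivAt (fun s : ℝ => expectation p n
      fun N => (∑ x, w x * N x) * Real.exp (∑ x, (s * v x) * N x))
      (expectation p n (fun N => (∑ x, v x * N x) * ∑ x, w x * N x)) 0 := by
    refine HasDerivAt.fun_sum fun N _ => HasDerivAt.const_mul _ ?_
    have : HasDerivAt (fun s : ℝ => ∑ x, (s * v x) * (N x : ℝ)) (∑ x, v x * N x) 0 := by
      refine HasDerivAt.fun_sum fun x _ => HasDerivAt.mul_const ?_ _
      simpa using (hasDerivAt_id (0 : ℝ)).mul_const (v x)
    simpa [mul_comm] using this.exp.const_mul (∑ x, w x * (N x : ℝ))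
  have he (x : Cell r c) : HasDerivAt (fun s : ℝ => Real.exp (s * v x)) (v x) 0 := by
    simpa using ((hasDerivAt_id (0 : ℝ)).mul_const (v x)).exp
  have h2 : HasDerivAt (fun s : ℝ => n * (∑ x, p x * Real.exp (s * v x)) ^ (n - 1) *
      ∑ x, p x * (w x * Real.exp (s * v x)))
      (n * ((n - 1 : ℕ) * ∑ x, p x * v x) * (∑ x, p x * w x) + n * ∑ x, p x * (w x * v x)) 0 := by
    have h3 : HasDerivAt (fun s : ℝ => ∑ x, p x * Real.exp (s * v x)) (∑ x, p x * v x) 0 :=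
      HasDerivAt.fun_sum fun x _ => (he x).const_mul _
    have h4 : HasDerivAt (fun s : ℝ => ∑ x, p x * (w x * Real.exp (s * v x)))
        (∑ x, p x * (w x * v x)) 0 :=
      HasDerivAt.fun_sum fun x _ => ((he x).const_mul _).const_mul _
    simpa [hp.2] using ((h3.fun_pow (n - 1)).const_mul (n : ℝ)).fun_mul h4
  simp only [expectation_linear_mul_exp] at h1
  rw [h1.unique h2]
  simp only [mul_comm (w _)]
  -- The exponent `n - 1` is truncated at `n = 0`, where the prefactor `n` vanishes anyway.
  rcases n with _ | n
  · simp
  · push_cast [Nat.add_sub_cancel]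
    ring

/-- The deviation of the sample proportions from the cell probabilities. -/
def deviation (p : Cell r c → ℝ) (n : ℕ) (N : Cell r c → ℕ) : Cell r c → ℝ :=
  fun x => (N x : ℝ) / n - p x

/-- Since the counts sum to `n`, the constant `p x` is absorbed into a homogeneous linear form. Its
coefficients have `p`-mean zero, which kills the first moment and the `n (n - 1)` part of the
second. -/
lemma deviation_eq_linear {p : Cell r c → ℝ} {n : ℕ} (hn : 0 < n) {N : Cell r c → ℕ}
    (hN : N ∈ tables r c n) (x : Cell r c) :
    deviation p n N x = ∑ y, ((if y = x then 1 else 0) - p x) / n * (N y : ℝ) := by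
  have hn' : (n : ℝ) ≠ 0 := by positivity
  have hs : ∑ y, (N y : ℝ) = n := by exact_mod_cast sum_of_mem_tables hN
  simp only [sub_div, sub_mul, Finset.sum_sub_distrib, ← Finset.mul_sum, hs, deviation]
  simp [ite_div, ite_mul]
  field_simp

lemma sum_mul_indicator_sub {p : Cell r c → ℝ} (hp : p ∈ stdSimplex ℝ (Cell r c)) (x : Cell r c) :
    ∑ y, p y * ((if y = x then 1 else 0) - p x) = 0 := by
  simp [mul_sub, Finset.sum_sub_distrib, ← Finset.sum_mul, hp.2]

lemma expectation_deviation {p : Cell r c → ℝ} (hp : p ∈ stdSimplex ℝ (Cell r c)) {n : ℕ}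
    (hn : 0 < n) (x : Cell r c) : expectation p n (fun N => deviation p n N x) = 0 := by
  rw [expectation_congr fun N hN => deviation_eq_linear hn hN x, expectation_linear hp]
  simp only [← mul_div_assoc, ← Finset.sum_div, sum_mul_indicator_sub hp x]
  simp

lemma expectation_deviation_mul {p : Cell r c → ℝ} (hp : p ∈ stdSimplex ℝ (Cell r c)) {n : ℕ}
    (hn : 0 < n) (x y : Cell r c) :
    expectation p n (fun N => deviation p n N x * deviation p n N y) = covMat p x y / n := by
  have hn' : (n : ℝ) ≠ 0 := by positivity
  rw [expectation_congr fun N hN => by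
    rw [deviation_eq_linear hn hN x, deviation_eq_linear hn hN y],
    expectation_linear_mul_linear hp]
  have h0 (z : Cell r c) : ∑ y, p y * (((if y = z then 1 else 0) - p z) / n) = 0 := by
    simp only [← mul_div_assoc, ← Finset.sum_div, sum_mul_indicator_sub hp z]
    simp
  have h1 : ∑ z, p z * (((if z = x then 1 else 0) - p x) / n * (((if z = y then 1 else 0) - p y) / n))
      = covMat p x y / (n * n : ℝ) := by
    have h2 (z : Cell r c) :
        p z * (((if z = x then 1 else 0) - p x) / n * (((if z = y then 1 else 0) - p y) / n)) =
        (p z * ((if z = x then 1 else 0) - p x) * (if z = y then 1 else 0) -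
          p y * (p z * ((if z = x then 1 else 0) - p x))) / (n * n : ℝ) := by
      field_simp
    simp only [h2, ← Finset.sum_div, Finset.sum_sub_distrib, ← Finset.mul_sum,
      sum_mul_indicator_sub hp x]
    congr 1
    simp only [covMat, Matrix.sub_apply, Matrix.diagonal_apply, Matrix.vecMulVec_apply]
    by_cases h : x = y
    · subst h; simp; ring
    · simp [h, Ne.symm h]; ring
  rw [h0, h1]
  field_simp
  ring

/-! ### Exponential concentration of the sample proportions -/

lemma expectation_exp_deviation_le {p : Cell r c → ℝ} (hp : p ∈ stdSimplex ℝ (Cell r c)) {n : ℕ}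
    (hn : 0 < n) (x : Cell r c) {s : ℝ} (hs : |s| ≤ 1) :
    expectation p n (fun N => Real.exp (s * n * deviation p n N x)) ≤ Real.exp (s ^ 2 * n) := by
  have hn' : (n : ℝ) ≠ 0 := by positivity
  have hx0 := hp.1 x
  have hx1 : p x ≤ 1 := by
    rw [← hp.2]; exact Finset.single_le_sum (fun y _ => hp.1 y) (Finset.mem_univ x)
  have h1 : expectation p n (fun N => Real.exp (s * n * deviation p n N x)) =
      (∑ y, p y * Real.exp (s * ((if y = x then 1 else 0) - p x))) ^ n := by
    rw [← expectation_exp]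
    refine expectation_congr fun N hN => ?_
    rw [deviation_eq_linear hn hN x, Finset.mul_sum]
    congr 1
    refine Finset.sum_congr rfl fun y _ => ?_
    field_simp
  -- For one draw, `exp (s z) ≤ 1 + s z + s²` when `|s|, |z| ≤ 1`; the linear term averages to zero,
  -- leaving `1 + s² ≤ exp (s²)`.
  have h2 : ∑ y, p y * Real.exp (s * ((if y = x then 1 else 0) - p x)) ≤ Real.exp (s ^ 2) := by
    calc _ ≤ ∑ y, (p y + s * (p y * ((if y = x then 1 else 0) - p x)) + p y * s ^ 2) := by
          refine Finset.sum_le_sum fun y _ => ?_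
          have hz : |((if y = x then 1 else 0 : ℝ) - p x)| ≤ 1 := by
            split_ifs <;> rw [abs_le] <;> constructor <;> linarith
          set z := ((if y = x then 1 else 0 : ℝ) - p x)
          have hz1 : |s * z| ≤ |s| := by
            rw [abs_mul]; exact mul_le_of_le_one_right (abs_nonneg _) hz
          have h3 := (abs_le.1 (Real.abs_exp_sub_one_sub_id_le (hz1.trans hs))).2
          have h4 : (s * z) ^ 2 ≤ s ^ 2 := sq_le_sq.2 hz1
          nlinarith [hp.1 y]
      _ = 1 + s ^ 2 := by
          rw [Finset.sum_add_distrib, Finset.sum_add_distrib, ← Finset.mul_sum,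
            sum_mul_indicator_sub hp x, ← Finset.sum_mul, hp.2]
          ring
      _ ≤ _ := by linarith [Real.add_one_le_exp (s ^ 2)]
  rw [h1, mul_comm (s ^ 2), Real.exp_nat_mul]
  exact pow_le_pow_left₀
    (Finset.sum_nonneg fun y _ => mul_nonneg (hp.1 y) (Real.exp_pos _).le) h2 n

/-- The sample proportions have exponentially small probability of being far from `p`. -/
lemma exists_tail_bound {p : Cell r c → ℝ} (hp : p ∈ stdSimplex ℝ (Cell r c)) {δ : ℝ}
    (hδ : 0 < δ) : ∃ B a : ℝ, 0 < a ∧ ∀ n : ℕ, 0 < n →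
      expectation p n (fun N => if ‖deviation p n N‖ < δ then 0 else 1) ≤ B * Real.exp (-a * n) := by
  -- Chernoff parameter: `s ≤ 1` is needed for the exponential moment, and `s ≤ δ / 2` gives `-s δ +
  -- s² ≤ -s²`. The factor 2 per cell counts both signs of the deviation.
  set s := min (δ / 2) 1 with hs
  have hs0 : 0 < s := by positivity
  have hsd : s ≤ δ / 2 := min_le_left _ _
  have hs1 : s ≤ 1 := min_le_right _ _
  refine ⟨∑ x : Cell r c, 2, s ^ 2, by positivity, fun n hn => ?_⟩
  calc _ ≤ expectation p n (fun N => ∑ x, (Real.exp (-(s * n * δ)) *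
          (Real.exp (s * n * deviation p n N x) + Real.exp (-s * n * deviation p n N x)))) := by
        refine expectation_mono hp.1 fun N _ => ?_
        have hnn : ∀ x ∈ (Finset.univ : Finset (Cell r c)), 0 ≤ Real.exp (-(s * n * δ)) *
          (Real.exp (s * n * deviation p n N x) + Real.exp (-s * n * deviation p n N x)) :=
          fun x _ => by positivity
        split_ifs with h
        · exact Finset.sum_nonneg hnn
        · rw [pi_norm_lt_iff hδ] at h
          push Not at h
          obtain ⟨x, hx⟩ := h
          refine le_trans ?_ (Finset.single_le_sum hnn (Finset.mem_univ x))
          rw [mul_add, ← Real.exp_add, ← Real.exp_add]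
          rw [Real.norm_eq_abs, le_abs] at hx
          have hsn : 0 ≤ s * n := by positivity
          rcases hx with hx | hx
          · have : 1 ≤ Real.exp (-(s * n * δ) + s * n * deviation p n N x) :=
              Real.one_le_exp (by nlinarith)
            linarith [Real.exp_pos (-(s * n * δ) + -s * n * deviation p n N x)]
          · have : 1 ≤ Real.exp (-(s * n * δ) + -s * n * deviation p n N x) :=
              Real.one_le_exp (by nlinarith)
            linarith [Real.exp_pos (-(s * n * δ) + s * n * deviation p n N x)]
    _ ≤ _ := by
        rw [expectation_sum, Finset.sum_mul]
        refine Finset.sum_le_sum fun x _ => ?_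
        rw [expectation_const_mul, expectation_add]
        have h1 := expectation_exp_deviation_le hp hn x (s := s) (by rwa [abs_of_pos hs0])
        have h2 := expectation_exp_deviation_le hp hn x (s := -s) (by rwa [abs_neg, abs_of_pos hs0])
        rw [neg_sq] at h2
        calc _ ≤ Real.exp (-(s * n * δ)) * (2 * Real.exp (s ^ 2 * n)) := by
              gcongr; linarith
          _ = 2 * Real.exp (-(s * n * δ) + s ^ 2 * n) := by rw [Real.exp_add]; ring
          _ ≤ _ := by
              gcongr
              nlinarith [mul_nonneg hs0.le (Nat.cast_nonneg (α := ℝ) n)]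

/-! ### Second order expansion of differences of squared errors -/

section taylor

variable {E : Type*} [NormedAddCommGroup E] [NormedSpace ℝ E]

/-- The remainder of the second order Taylor polynomial with coefficients `g`, `H` at `p`. -/
def taylorRem (f : E → ℝ) (p : E) (g : E →L[ℝ] ℝ) (H : E →L[ℝ] E →L[ℝ] ℝ) (h : E) : ℝ :=
  f (p + h) - f p - g h - 1 / 2 * H h h

/-- The remainder has derivative `f'(p + x) - f'(p) - H x = o(x)`, using the symmetry of `H`, so the
mean value inequality applies on a ball. The factor `‖h - k‖` is the gain over bounding the two
remainders separately. -/
lemma exists_taylorRem_sub_le {f : E → ℝ} {p : E} {H : E →L[ℝ] E →L[ℝ] ℝ}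
    (hf : ∀ᶠ x in 𝓝 p, DifferentiableAt ℝ f x) (hH : HasFDerivAt (fderiv ℝ f) H p)
    {ε : ℝ} (hε : 0 < ε) : ∃ δ > 0, ∀ h k : E, ‖h‖ < δ → ‖k‖ < δ →
      |taylorRem f p (fderiv ℝ f p) H h - taylorRem f p (fderiv ℝ f p) H k| ≤
        ε * (‖h‖ + ‖k‖) * ‖h - k‖ := by
  have hsymm : ∀ v w, H v w = H w v :=
    second_derivative_symmetric_of_eventually (hf.mono fun x hx => hx.hasFDerivAt) hH
  have h1 := (hasFDerivAt_iff_isLittleO_nhds_zero.1 hH).def hε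
  have h2 : ∀ᶠ h in 𝓝 (0 : E), DifferentiableAt ℝ f (p + h) := by
    have : Tendsto (fun h : E => p + h) (𝓝 0) (𝓝 p) := by
      simpa using (continuous_const_add p).tendsto (0 : E)
    exact this.eventually hf
  obtain ⟨δ, hδ, hb⟩ := Metric.eventually_nhds_iff_ball.1 (h1.and h2)
  refine ⟨δ, hδ, fun h k hh hk => ?_⟩
  set ρ := max ‖h‖ ‖k‖
  have hρ : ρ < δ := max_lt hh hk
  have key := (convex_closedBall (0 : E) ρ).norm_image_sub_le_of_norm_hasFDerivWithin_le
    (f := taylorRem f p (fderiv ℝ f p) H)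
    (f' := fun x => fderiv ℝ f (p + x) - fderiv ℝ f p - H x) (C := ε * ρ) (x := k) (y := h)
    (fun x hx => ?_) (fun x hx => ?_) (by simp [ρ]) (by simp [ρ])
  · rw [← Real.norm_eq_abs]
    refine key.trans ?_
    gcongr
    exact max_le_add_of_nonneg (norm_nonneg _) (norm_nonneg _)
  · have hx' : x ∈ Metric.ball (0 : E) δ := by
      simp only [Metric.mem_closedBall, Metric.mem_ball] at hx ⊢
      linarith
    have d1 : HasFDerivAt (fun y : E => f (p + y)) (fderiv ℝ f (p + x)) x := by
      have := ((hb x hx').2.hasFDerivAt).comp x ((hasFDerivAt_id x).const_add p)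
      simpa [Function.comp_def] using this
    have d2 : HasFDerivAt (fun y : E => (1 / 2 : ℝ) * H y y) (H x) x := by
      have := (H.hasFDerivAt (x := x)).clm_apply (hasFDerivAt_id x)
      refine (this.const_mul (1 / 2 : ℝ)).congr_fderiv ?_
      ext w
      simp [hsymm w x]
      ring
    exact (((d1.sub_const (f p)).sub (fderiv ℝ f p).hasFDerivAt).sub d2).hasFDerivWithinAt
  · have hx' : x ∈ Metric.ball (0 : E) δ := by
      simp only [Metric.mem_closedBall, Metric.mem_ball] at hx ⊢
      linarith
    refine (hb x hx').1.trans ?_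
    gcongr
    simpa using hx

lemma abs_mul_le_of_le {a b A B : ℝ} (ha : |a| ≤ A) (hb : |b| ≤ B) : |a * b| ≤ A * B := by
  rw [abs_mul]
  exact mul_le_mul ha hb (abs_nonneg _) ((abs_nonneg _).trans ha)

/-- The leading part of the difference of squared errors, divided by minus the difference of the
two shrinkage weights; `σ` is the sum of the weights. -/
def leadingTerm (g : E →L[ℝ] ℝ) (H : E →L[ℝ] E →L[ℝ] ℝ) (K : ℝ) (d : E) (σ : ℝ) (u : E) : ℝ :=
  2 * g d * g u - σ * g d ^ 2 + g d * H u u + 2 * K * g u ^ 2 + 2 * (g u * H u d)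

-- Factor the difference of squares as `(R₁ - Δ (g d + A)) (2 g u + B + R₂)`, with `Δ = b - b'`. On
-- the scale `‖u‖ ≤ s`, `b, b' = O(s²)`, one has `A = O(s)`, `B = O(s²)`, `R₁ = O(ε s |Δ|)` and `R₂
-- = O(ε s²)`. The terms `2 g d g u + g d B + 2 g u A` form `leadingTerm`; all others are `O(ε |Δ|
-- s²)`.
set_option maxHeartbeats 1000000 in
lemma abs_sq_sub_sq_add_le {f : E → ℝ} {p : E} {g : E →L[ℝ] ℝ} {H : E →L[ℝ] E →L[ℝ] ℝ}
    (hsymm : ∀ v w, H v w = H w v) {K C s ε b b' : ℝ} {d u : E} (hC : 1 ≤ C) (hg : ‖g‖ ≤ C)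
    (hH : ‖H‖ ≤ C) (hd : ‖d‖ ≤ C) (hK : |K| ≤ C) (hs : s ≤ 1) (hu : ‖u‖ ≤ s) (hsε : s ≤ ε)
    (hε : ε ≤ 1) (hb : |b| ≤ C * s ^ 2) (hb' : |b'| ≤ C * s ^ 2)
    (hT : ∀ h k, ‖h‖ ≤ 3 * C ^ 2 * s → ‖k‖ ≤ 3 * C ^ 2 * s →
      |taylorRem f p g H h - taylorRem f p g H k| ≤ ε * (‖h‖ + ‖k‖) * ‖h - k‖) :
    |(f (p + (u - b • (K • u + d))) - f p) ^ 2 - (f (p + (u - b' • (K • u + d))) - f p) ^ 2 +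
      (b - b') * leadingTerm g H K d (b + b') u| ≤ 700 * C ^ 9 * ε * |b - b'| * s ^ 2 := by
  have hs0 : 0 ≤ s := (norm_nonneg u).trans hu
  have hε0 : 0 ≤ ε := hs0.trans hsε
  have hC0 : 0 ≤ C := by linarith
  have hu1 : ‖u‖ ≤ 1 := hu.trans hs
  set v := K • u + d with hv
  have hvn : ‖v‖ ≤ 2 * C := by
    calc ‖v‖ ≤ |K| * ‖u‖ + ‖d‖ := by
          refine (norm_add_le _ _).trans ?_
          rw [norm_smul, Real.norm_eq_abs]
      _ ≤ C * 1 + C := by gcongr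
      _ = 2 * C := by ring
  have gb (x : E) {X : ℝ} (hx : ‖x‖ ≤ X) : |g x| ≤ C * X :=
    (g.le_opNorm x).trans (by gcongr)
  have Hb (x y : E) {X Y : ℝ} (hx : ‖x‖ ≤ X) (hy : ‖y‖ ≤ Y) : |H x y| ≤ C * X * Y := by
    refine (H.le_opNorm₂ x y).trans ?_
    have : 0 ≤ X := (norm_nonneg x).trans hx
    gcongr
  have hgu := gb u hu
  have hgd := gb d hd
  have hHuu := Hb u u hu hu
  have hHud := Hb u d hu hd
  have hHuv := Hb u v hu hvn
  have hHvv := Hb v v hvn hvn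
  have hnorm {β : ℝ} (hβ : |β| ≤ C * s ^ 2) : ‖u - β • v‖ ≤ 3 * C ^ 2 * s := by
    calc ‖u - β • v‖ ≤ ‖u‖ + |β| * ‖v‖ := by
          refine (norm_sub_le _ _).trans ?_
          rw [norm_smul, Real.norm_eq_abs]
      _ ≤ s + C * s ^ 2 * (2 * C) := by gcongr
      _ ≤ 3 * C ^ 2 * s := by
          have h1 : s ^ 2 ≤ s := pow_le_of_le_one hs0 hs two_ne_zero
          have h2 : 1 ≤ C ^ 2 := one_le_pow₀ hC
          nlinarith [mul_le_mul_of_nonneg_left h1 (sq_nonneg C), mul_le_mul_of_nonneg_right h2 hs0]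
  have hh := hnorm hb
  have hh' := hnorm hb'
  set h := u - b • v with hdef
  set h' := u - b' • v with hdef'
  have hφ0 : taylorRem f p g H 0 = 0 := by simp [taylorRem]
  have hφ {x : E} (hx : ‖x‖ ≤ 3 * C ^ 2 * s) : |taylorRem f p g H x| ≤ 9 * C ^ 4 * ε * s ^ 2 := by
    have := hT x 0 hx (by simp; positivity)
    rw [hφ0, sub_zero, sub_zero, norm_zero, add_zero] at this
    calc _ ≤ _ := this
      _ ≤ ε * (3 * C ^ 2 * s) * (3 * C ^ 2 * s) := by gcongr
      _ = _ := by ring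
  have hφd : |taylorRem f p g H h - taylorRem f p g H h'| ≤ 12 * C ^ 3 * ε * s * |b - b'| := by
    have h1 : h - h' = -((b - b') • v) := by rw [hdef, hdef', sub_smul]; abel
    calc _ ≤ _ := hT h h' hh hh'
      _ ≤ ε * (3 * C ^ 2 * s + 3 * C ^ 2 * s) * (|b - b'| * (2 * C)) := by
          rw [h1, norm_neg, norm_smul, Real.norm_eq_abs]
          gcongr
      _ = _ := by ring
  have hφh := hφ hh
  have hφh' := hφ hh'
  have hgv : g v = K * g u + g d := by simp [hv]
  have hHuv' : H u v = K * H u u + H u d := by simp [hv]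
  have eg (β : ℝ) : g (u - β • v) = g u - β * g v := by simp
  have eH (β : ℝ) : H (u - β • v) (u - β • v) = H u u - 2 * β * H u v + β ^ 2 * H v v := by
    simp [hsymm v u]; ring
  have eS : f (p + h) - f p = g h + 1 / 2 * H h h + taylorRem f p g H h := by
    simp [taylorRem]
  have eS' : f (p + h') - f p = g h' + 1 / 2 * H h' h' + taylorRem f p g H h' := by
    simp [taylorRem]
  generalize taylorRem f p g H h = φ at *
  generalize taylorRem f p g H h' = φ' at *
  set Δ := b - b' with hΔ
  set σ := b + b' with hσ
  have hσb : |σ| ≤ 2 * C * s ^ 2 := by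
    calc |σ| ≤ |b| + |b'| := abs_add_le _ _
      _ ≤ _ := by linarith
  obtain ⟨R₁, hR₁⟩ : ∃ R, R = -Δ * (K * H u u - 1 / 2 * (σ * H v v)) + (φ - φ') := ⟨_, rfl⟩
  obtain ⟨R₂, hR₂⟩ : ∃ R, R = -(σ * K * g u) - σ * H u v +
    1 / 2 * (b * b * H v v + b' * b' * H v v) + (φ + φ') := ⟨_, rfl⟩
  obtain ⟨A, hA⟩ : ∃ A, A = K * g u + H u d := ⟨_, rfl⟩
  obtain ⟨B, hB⟩ : ∃ B, B = -(σ * g d) + H u u := ⟨_, rfl⟩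
  have pw {i j : ℕ} (hij : i ≤ j) : C ^ i ≤ C ^ j := pow_le_pow_right₀ hC hij
  have pw15 : C ≤ C ^ 5 := by simpa using pw (i := 1) (j := 5) (by norm_num)
  have pw13 : C ^ 1 ≤ C ^ 3 := pw (by norm_num)
  have pw24 : C ^ 2 ≤ C ^ 4 := pw (by norm_num)
  have pw34 : C ^ 3 ≤ C ^ 4 := pw (by norm_num)
  have pw35 : C ^ 3 ≤ C ^ 5 := pw (by norm_num)
  have pw45 : C ^ 4 ≤ C ^ 5 := pw (by norm_num)
  have pw59 : C ^ 5 ≤ C ^ 9 := pw (by norm_num)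
  have pw79 : C ^ 7 ≤ C ^ 9 := pw (by norm_num)
  have hs2 : s ^ 2 ≤ ε * s := by
    rw [sq]; exact mul_le_mul_of_nonneg_right hsε hs0
  have hs3 : s ^ 3 ≤ ε * s ^ 2 := by
    rw [pow_succ']; exact mul_le_mul_of_nonneg_right hsε (sq_nonneg s)
  have hs4 : s ^ 4 ≤ ε * s ^ 2 := by
    have : s ^ 4 ≤ s ^ 3 := pow_le_pow_of_le_one hs0 hs (by norm_num)
    linarith
  have bR₁ : |R₁| ≤ 17 * C ^ 4 * ε * s * |Δ| := by
    have h1 := abs_mul_le_of_le hK hHuu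
    have h2 := abs_mul_le_of_le hσb hHvv
    have h3 : |K * H u u - 1 / 2 * (σ * H v v)| ≤ 5 * C ^ 4 * ε * s := by
      calc _ ≤ |K * H u u| + |1 / 2 * (σ * H v v)| := abs_sub _ _
        _ ≤ C * (C * s * s) + 1 / 2 * (2 * C * s ^ 2 * (C * (2 * C) * (2 * C))) := by
            rw [abs_mul (1 / 2), abs_of_pos (by norm_num : (0 : ℝ) < 1 / 2)]
            gcongr
        _ = (C ^ 2 + 4 * C ^ 4) * s ^ 2 := by ring
        _ ≤ (C ^ 4 + 4 * C ^ 4) * (ε * s) := by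
            gcongr
        _ = _ := by ring
    calc |R₁| ≤ |Δ| * |K * H u u - 1 / 2 * (σ * H v v)| + |φ - φ'| := by
          rw [hR₁]
          refine (abs_add_le _ _).trans ?_
          rw [abs_mul, abs_neg]
      _ ≤ |Δ| * (5 * C ^ 4 * ε * s) + 12 * C ^ 3 * ε * s * |Δ| := by gcongr
      _ ≤ |Δ| * (5 * C ^ 4 * ε * s) + 12 * C ^ 4 * ε * s * |Δ| := by
          gcongr |Δ| * (5 * C ^ 4 * ε * s) + 12 * ?_ * ε * s * |Δ|
      _ = _ := by ring
  have bR₂ : |R₂| ≤ 28 * C ^ 5 * ε * s ^ 2 := by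
    have h1 := abs_mul_le_of_le (abs_mul_le_of_le hσb hK) hgu
    have h2 := abs_mul_le_of_le hσb hHuv
    have h3 := abs_mul_le_of_le (abs_mul_le_of_le hb hb) hHvv
    have h4 := abs_mul_le_of_le (abs_mul_le_of_le hb' hb') hHvv
    rw [abs_le] at h1 h2 h3 h4 hφh hφh'
    calc |R₂| ≤ 6 * C ^ 3 * s ^ 3 + 4 * C ^ 5 * s ^ 4 + 18 * C ^ 4 * (ε * s ^ 2) := by
          rw [hR₂, abs_le]
          constructor <;> linarith [h1.1, h1.2, h2.1, h2.2, h3.1, h3.2, h4.1, h4.2]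
      _ ≤ 6 * C ^ 5 * (ε * s ^ 2) + 4 * C ^ 5 * (ε * s ^ 2) + 18 * C ^ 5 * (ε * s ^ 2) := by
          gcongr 6 * ?_ * ?_ + 4 * C ^ 5 * ?_ + 18 * ?_ * (ε * s ^ 2)
      _ = _ := by ring
  have bA : |A| ≤ 2 * C ^ 2 * s := by
    have h1 := abs_mul_le_of_le hK hgu
    calc |A| ≤ |K * g u| + |H u d| := by rw [hA]; exact abs_add_le _ _
      _ ≤ C * (C * s) + C * s * C := by gcongr
      _ = _ := by ring
  have bB : |B| ≤ 3 * C ^ 3 * s ^ 2 := by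
    have h1 := abs_mul_le_of_le hσb hgd
    calc |B| ≤ |σ * g d| + |H u u| := by
          rw [hB]; refine (abs_add_le _ _).trans ?_; rw [abs_neg]
      _ ≤ 2 * C * s ^ 2 * (C * C) + C * s * s := by gcongr
      _ = 2 * C ^ 3 * s ^ 2 + C ^ 1 * s ^ 2 := by ring
      _ ≤ 2 * C ^ 3 * s ^ 2 + C ^ 3 * s ^ 2 := by
          rw [pow_one] at pw13 ⊢
          gcongr 2 * C ^ 3 * s ^ 2 + ?_ * s ^ 2
      _ = _ := by ring
  have bY : |2 * g u + B + R₂| ≤ 33 * C ^ 5 * s := by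
    have hss : s ^ 2 ≤ s := pow_le_of_le_one hs0 hs two_ne_zero
    calc _ ≤ |2 * g u| + |B| + |R₂| := abs_add_three _ _ _
      _ ≤ 2 * (C * s) + 3 * C ^ 3 * s ^ 2 + 28 * C ^ 5 * ε * s ^ 2 := by
          rw [abs_mul, abs_two]
          gcongr
      _ ≤ 2 * (C ^ 5 * s) + 3 * C ^ 5 * s + 28 * C ^ 5 * 1 * s := by
          gcongr 2 * (?_ * s) + 3 * ?_ * ?_ + 28 * C ^ 5 * ?_ * ?_
      _ = _ := by ring
  have bA0 : |g d + A| ≤ 3 * C ^ 2 := by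
    calc _ ≤ |g d| + |A| := abs_add_le _ _
      _ ≤ C * C + 2 * C ^ 2 * 1 := by
          gcongr
          exact bA.trans (by gcongr)
      _ = _ := by ring
  have eX : (f (p + h) - f p) - (f (p + h') - f p) = R₁ - Δ * (g d + A) := by
    rw [eS, eS', hdef, hdef', eg, eg, eH, eH, hgv, hR₁, hA, hΔ, hσ, hHuv']
    ring
  have eY : (f (p + h) - f p) + (f (p + h') - f p) = 2 * g u + B + R₂ := by
    rw [eS, eS', hdef, hdef', eg, eg, eH, eH, hgv, hR₂, hB, hσ]
    ring
  have eM : (f (p + h) - f p) ^ 2 - (f (p + h') - f p) ^ 2 + Δ * leadingTerm g H K d σ u =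
      R₁ * (2 * g u + B + R₂) - Δ * (A * B) - Δ * ((g d + A) * R₂) := by
    have : (f (p + h) - f p) ^ 2 - (f (p + h') - f p) ^ 2 =
        (R₁ - Δ * (g d + A)) * (2 * g u + B + R₂) := by rw [← eX, ← eY]; ring
    rw [this, leadingTerm, hA, hB]
    ring
  rw [eM]
  have t1 := abs_mul_le_of_le bR₁ bY
  have t2 := abs_mul_le_of_le (le_refl |Δ|) (abs_mul_le_of_le bA bB)
  have t3 := abs_mul_le_of_le (le_refl |Δ|) (abs_mul_le_of_le bA0 bR₂)
  -- Here `561 = 17 * 33`, `6 = 2 * 3` and `84 = 3 * 28` sum to `651 ≤ 700`.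
  calc _ ≤ |R₁ * (2 * g u + B + R₂)| + |Δ * (A * B)| + |Δ * ((g d + A) * R₂)| :=
        (abs_sub _ _).trans (by gcongr; exact abs_sub _ _)
    _ ≤ 17 * C ^ 4 * ε * s * |Δ| * (33 * C ^ 5 * s) + |Δ| * (2 * C ^ 2 * s * (3 * C ^ 3 * s ^ 2)) +
        |Δ| * (3 * C ^ 2 * (28 * C ^ 5 * ε * s ^ 2)) := by gcongr
    _ = |Δ| * (561 * C ^ 9 * (ε * s ^ 2) + 6 * C ^ 5 * s ^ 3 + 84 * C ^ 7 * (ε * s ^ 2)) := by ring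
    _ ≤ |Δ| * (561 * C ^ 9 * (ε * s ^ 2) + 6 * C ^ 9 * (ε * s ^ 2) + 84 * C ^ 9 * (ε * s ^ 2)) := by
        gcongr |Δ| * (561 * C ^ 9 * (ε * s ^ 2) + 6 * ?_ * ?_ + 84 * ?_ * (ε * s ^ 2))
    _ ≤ _ := by
        have : 0 ≤ |Δ| * (C ^ 9 * (ε * s ^ 2)) := by positivity
        linarith

/-- Near `p`, the difference of the squared errors of two shrunken estimates is, up to a small
error, a quadratic polynomial in the deviation `u`. -/
lemma exists_abs_sq_sub_sq_add_le {f : E → ℝ} {p : E} {H : E →L[ℝ] E →L[ℝ] ℝ}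
    (hf : ∀ᶠ x in 𝓝 p, DifferentiableAt ℝ f x) (hH : HasFDerivAt (fderiv ℝ f) H p)
    (K : ℝ) (d : E) (B : ℝ) {ε : ℝ} (hε : 0 < ε) :
    ∃ δ > 0, ∀ (u : E) (t b b' : ℝ), ‖u‖ < δ → 0 ≤ t → t < δ → |b| ≤ B * t → |b'| ≤ B * t →
      |(f (p + (u - b • (K • u + d))) - f p) ^ 2 - (f (p + (u - b' • (K • u + d))) - f p) ^ 2 +
        (b - b') * leadingTerm (fderiv ℝ f p) H K d (b + b') u| ≤
          ε * |b - b'| * (‖u‖ ^ 2 + t) := by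
  obtain ⟨C, hC, hgC, hHC, hdC, hKC, hBC⟩ : ∃ C : ℝ, 1 ≤ C ∧ ‖fderiv ℝ f p‖ ≤ C ∧ ‖H‖ ≤ C ∧
      ‖d‖ ≤ C ∧ |K| ≤ C ∧ |B| ≤ C := by
    have n1 := norm_nonneg (fderiv ℝ f p)
    have n2 := norm_nonneg H
    have n3 := norm_nonneg d
    have n4 := abs_nonneg K
    have n5 := abs_nonneg B
    refine ⟨1 + ‖fderiv ℝ f p‖ + ‖H‖ + ‖d‖ + |K| + |B|, ?_, ?_, ?_, ?_, ?_, ?_⟩ <;> linarith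
  have hC0 : 0 < C := by linarith
  set ε₀ := min 1 (ε / (700 * C ^ 9))
  have hε₀ : 0 < ε₀ := by positivity
  obtain ⟨δ₀, hδ₀, hT⟩ := exists_taylorRem_sub_le hf hH hε₀
  set η := min ε₀ (δ₀ / (4 * C ^ 2))
  have hη : 0 < η := by positivity
  -- With `‖u‖ < 1`, both `‖u‖²` and `t` lie below `η² / 2`, so `s = √(‖u‖² + t) ≤ η`. This `s`
  -- dominates `‖u‖`, and `s²` dominates `t`.
  refine ⟨min 1 (η ^ 2 / 2), by positivity, fun u t b b' hu ht0 ht hb hb' => ?_⟩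
  obtain ⟨hu1, hu2⟩ := lt_min_iff.1 hu
  obtain ⟨ht1, ht2⟩ := lt_min_iff.1 ht
  set s := √(‖u‖ ^ 2 + t)
  have hs2 : s ^ 2 = ‖u‖ ^ 2 + t := Real.sq_sqrt (by positivity)
  have hs0 : 0 ≤ s := Real.sqrt_nonneg _
  have hsη : s ≤ η := by
    refine Real.sqrt_le_iff.2 ⟨hη.le, ?_⟩
    nlinarith [norm_nonneg u]
  have hus : ‖u‖ ≤ s := Real.le_sqrt_of_sq_le (by linarith)
  have hts : t ≤ s ^ 2 := by rw [hs2]; nlinarith [norm_nonneg u]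
  have hbC {β : ℝ} (hβ : |β| ≤ B * t) : |β| ≤ C * s ^ 2 := by
    refine hβ.trans ?_
    have hBC' : B ≤ C := (le_abs_self B).trans hBC
    gcongr
  have hsδ : 3 * C ^ 2 * s < δ₀ := by
    have : s ≤ δ₀ / (4 * C ^ 2) := hsη.trans (min_le_right _ _)
    rw [le_div_iff₀ (by positivity)] at this
    nlinarith [pow_pos hC0 2]
  have hsε : s ≤ ε₀ := hsη.trans (min_le_left _ _)
  have key := abs_sq_sub_sq_add_le (f := f) (p := p) (g := fderiv ℝ f p) (H := H) (K := K)
    (C := C) (s := s) (ε := ε₀) (b := b) (b' := b') (d := d) (u := u)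
    (second_derivative_symmetric_of_eventually (hf.mono fun x hx => hx.hasFDerivAt) hH)
    hC hgC hHC hdC hKC
    (hsε.trans (min_le_left _ _)) hus hsε (min_le_left _ _) (hbC hb) (hbC hb')
    (fun h k hh hk => hT h k (hh.trans_lt hsδ) (hk.trans_lt hsδ))
  refine key.trans ?_
  rw [← hs2]
  have : 700 * C ^ 9 * ε₀ ≤ ε := by
    have : ε₀ ≤ ε / (700 * C ^ 9) := min_le_right _ _
    rw [le_div_iff₀ (by positivity)] at this
    linarith
  gcongr

end taylor

/-! ### Coordinates: gradient, Hessian and the coefficients -/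

lemma TimesDifferentiableAt.eventually_differentiableAt {m : ℕ} (hm : 1 < m)
    {f : (Cell r c → ℝ) → ℝ} {p : Cell r c → ℝ} (hf : TimesDifferentiableAt m f p) :
    ∀ᶠ x in 𝓝 p, DifferentiableAt ℝ f x := by
  have h := hf.1 0 hm
  rw [iteratedFDeriv_zero_eq_comp] at h
  exact h.mono fun x hx => (LinearIsometryEquiv.comp_differentiableAt_iff _).1 hx

lemma TimesDifferentiableAt.differentiableAt_fderiv {m : ℕ} (hm : 1 < m)
    {f : (Cell r c → ℝ) → ℝ} {p : Cell r c → ℝ} (hf : TimesDifferentiableAt m f p) :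
    DifferentiableAt ℝ (fderiv ℝ f) p := by
  have h : fderiv ℝ f = continuousMultilinearCurryFin1 ℝ (Cell r c → ℝ) ℝ ∘
      iteratedFDeriv ℝ 1 f := by
    ext x v
    simp [iteratedFDeriv_one_apply]
  rw [h, LinearIsometryEquiv.comp_differentiableAt_iff]
  exact hf.2 1 hm

lemma hess_apply {f : (Cell r c → ℝ) → ℝ} {p : Cell r c → ℝ}
    (hf : DifferentiableAt ℝ (fderiv ℝ f) p) (x y : Cell r c) :
    hess f p x y = fderiv ℝ (fderiv ℝ f) p (Pi.single x 1) (Pi.single y 1) := by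
  have h : HasFDerivAt (partialDeriv f y)
      ((ContinuousLinearMap.apply ℝ ℝ (Pi.single y (1 : ℝ) : Cell r c → ℝ)).comp
        (fderiv ℝ (fderiv ℝ f) p)) p :=
    (ContinuousLinearMap.apply ℝ ℝ (Pi.single y (1 : ℝ) : Cell r c → ℝ)).hasFDerivAt.comp p
      hf.hasFDerivAt
  rw [hess, Matrix.of_apply, partialDeriv, h.fderiv]
  rfl

lemma clm_apply_eq_sum (g : (Cell r c → ℝ) →L[ℝ] ℝ) (u : Cell r c → ℝ) :
    g u = ∑ x, u x * g (Pi.single x 1) := by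
  conv_lhs => rw [← Finset.univ_sum_single u, map_sum]
  refine Finset.sum_congr rfl fun x _ => ?_
  rw [← smul_eq_mul, ← map_smul, ← Pi.single_smul, smul_eq_mul, mul_one]

lemma clm_apply_apply_eq_sum (H : (Cell r c → ℝ) →L[ℝ] (Cell r c → ℝ) →L[ℝ] ℝ)
    (u v : Cell r c → ℝ) :
    H u v = ∑ x, ∑ y, u x * (v y * H (Pi.single x 1) (Pi.single y 1)) := by
  have h (x : Cell r c) := clm_apply_eq_sum (H (Pi.single x 1)) v
  have h' := clm_apply_eq_sum (H.flip v) u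
  simp only [ContinuousLinearMap.flip_apply] at h'
  rw [h']
  exact Finset.sum_congr rfl fun x _ => by rw [h x, Finset.mul_sum]

lemma covMat_symm (p : Cell r c → ℝ) (x y : Cell r c) : covMat p x y = covMat p y x := by
  simp only [covMat, Matrix.sub_apply, Matrix.diagonal_apply, Matrix.vecMulVec_apply]
  by_cases h : x = y
  · rw [h]
  · simp [h, Ne.symm h, mul_comm]

lemma fderiv_shift (f : (Cell r c → ℝ) → ℝ) (p : Cell r c → ℝ) :
    fderiv ℝ f p (shift p) = ∑ x, shift p x * grad f p x :=
  clm_apply_eq_sum _ _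

lemma A1_eq (f : (Cell r c → ℝ) → ℝ) (p : Cell r c → ℝ) :
    A1 f p = fderiv ℝ f p (shift p) ^ 2 := by
  rw [fderiv_shift, sq, Finset.sum_mul_sum, A1, Matrix.trace]
  simp only [Matrix.diag_apply, Matrix.mul_apply, Matrix.vecMulVec_apply]
  exact Finset.sum_congr rfl fun x _ => Finset.sum_congr rfl fun y _ => by ring

/-- Symmetry of the Hessian and of the covariance merges the three traces into one pairing with
`covMat`, the form in which the mean of a quadratic form in `u` appears. -/
lemma two_mul_A2_eq {f : (Cell r c → ℝ) → ℝ} {p : Cell r c → ℝ}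
    (hf : ∀ᶠ x in 𝓝 p, DifferentiableAt ℝ f x) (hf' : DifferentiableAt ℝ (fderiv ℝ f) p) :
    2 * A2 f p = ∑ x, ∑ y, (fderiv ℝ f p (shift p) * hess f p x y +
      2 * ((r : ℝ) * c) * (grad f p x * grad f p y) +
      2 * (grad f p x * ∑ z, shift p z * hess f p y z)) * covMat p x y := by
  have hsymm (x y : Cell r c) : hess f p x y = hess f p y x := by
    rw [hess_apply hf', hess_apply hf']
    exact second_derivative_symmetric_of_eventually (hf.mono fun x hx => hx.hasFDerivAt)
      hf'.hasFDerivAt _ _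
  have h1 : (hess f p * covMat p).trace = ∑ x, ∑ y, hess f p x y * covMat p x y := by
    simp only [Matrix.trace, Matrix.diag_apply, Matrix.mul_apply]
    exact Finset.sum_congr rfl fun x _ => Finset.sum_congr rfl fun y _ => by rw [covMat_symm]
  have h2 : (Matrix.vecMulVec (grad f p) (grad f p) * covMat p).trace =
      ∑ x, ∑ y, grad f p x * grad f p y * covMat p x y := by
    simp only [Matrix.trace, Matrix.diag_apply, Matrix.mul_apply, Matrix.vecMulVec_apply]
    exact Finset.sum_congr rfl fun x _ => Finset.sum_congr rfl fun y _ => by rw [covMat_symm]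
  have h3 : (Matrix.vecMulVec (grad f p) (shift p) * hess f p * covMat p).trace =
      ∑ x, ∑ y, grad f p x * (∑ z, shift p z * hess f p y z) * covMat p x y := by
    simp only [Matrix.trace, Matrix.diag_apply, Matrix.mul_apply, Matrix.vecMulVec_apply]
    refine Finset.sum_congr rfl fun x _ => Finset.sum_congr rfl fun y _ => ?_
    rw [covMat_symm, Finset.mul_sum]
    congr 1
    exact Finset.sum_congr rfl fun z _ => by rw [hsymm y z]; ring
  rw [A2, h1, h2, h3, fderiv_shift, dotProduct]
  simp only [add_mul, Finset.sum_add_distrib, mul_assoc, ← Finset.mul_sum]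
  ring

/-- The linear part has mean zero, the quadratic part pairs with `covMat p / n`, and the constant is
`-σ (g d)² = -σ A₁`. -/
lemma expectation_leadingTerm {f : (Cell r c → ℝ) → ℝ} {p : Cell r c → ℝ}
    (hp : p ∈ stdSimplex ℝ (Cell r c)) (hf : ∀ᶠ x in 𝓝 p, DifferentiableAt ℝ f x)
    (hf' : DifferentiableAt ℝ (fderiv ℝ f) p) {n : ℕ} (hn : 0 < n) (σ : ℝ) :
    expectation p n (fun N => leadingTerm (fderiv ℝ f p) (fderiv ℝ (fderiv ℝ f) p) ((r : ℝ) * c)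
      (shift p) σ (deviation p n N)) = 2 * A2 f p / n - σ * A1 f p := by
  set gd := fderiv ℝ f p (shift p)
  have e (u : Cell r c → ℝ) : leadingTerm (fderiv ℝ f p) (fderiv ℝ (fderiv ℝ f) p) ((r : ℝ) * c)
      (shift p) σ u = (∑ x, 2 * gd * grad f p x * u x) - σ * gd ^ 2 + ∑ x, ∑ y,
      (gd * hess f p x y + 2 * ((r : ℝ) * c) * (grad f p x * grad f p y) +
        2 * (grad f p x * ∑ z, shift p z * hess f p y z)) * (u x * u y) := by
    have e1 : fderiv ℝ f p u = ∑ x, u x * grad f p x := clm_apply_eq_sum _ _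
    have e2 (v : Cell r c → ℝ) : fderiv ℝ (fderiv ℝ f) p u v =
        ∑ x, ∑ y, u x * (v y * hess f p x y) := by
      rw [clm_apply_apply_eq_sum]
      simp only [hess_apply hf']
    have s1 : (∑ x, 2 * gd * grad f p x * u x) = 2 * gd * ∑ x, u x * grad f p x := by
      rw [Finset.mul_sum]
      exact Finset.sum_congr rfl fun x _ => by ring
    have s2 : ∑ x, ∑ y, (gd * hess f p x y + 2 * ((r : ℝ) * c) * (grad f p x * grad f p y) +
        2 * (grad f p x * ∑ z, shift p z * hess f p y z)) * (u x * u y) =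
        gd * (∑ x, ∑ y, u x * (u y * hess f p x y)) +
        2 * ((r : ℝ) * c) * ((∑ x, u x * grad f p x) * ∑ x, u x * grad f p x) +
        2 * ((∑ x, u x * grad f p x) * ∑ x, ∑ y, u x * (shift p y * hess f p x y)) := by
      rw [Finset.sum_mul_sum, Finset.sum_mul_sum]
      simp only [Finset.mul_sum, ← Finset.sum_add_distrib]
      refine Finset.sum_congr rfl fun x _ => Finset.sum_congr rfl fun y _ => ?_
      rw [add_mul, add_mul, Finset.sum_mul]
      congr 1
      · ring
      · exact Finset.sum_congr rfl fun z _ => by ring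
    rw [leadingTerm, s1, s2, e2, e2, e1]
    ring
  simp only [e, expectation_add, expectation_sub, expectation_sum, expectation_const_mul,
    expectation_deviation hp hn, expectation_deviation_mul hp hn, expectation_const hp]
  rw [two_mul_A2_eq hf hf', A1_eq]
  simp only [mul_zero, Finset.sum_const_zero, ← mul_div_assoc, ← Finset.sum_div]
  ring

/-! ### Size bounds and the shrinkage form of the posterior mean -/

lemma norm_deviation_le_one {p : Cell r c → ℝ} (hp : p ∈ stdSimplex ℝ (Cell r c)) {n : ℕ}
    (hn : 0 < n) {N : Cell r c → ℕ} (hN : N ∈ tables r c n) : ‖deviation p n N‖ ≤ 1 := by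
  have hn' : (0 : ℝ) < n := by positivity
  refine (pi_norm_le_iff_of_nonneg zero_le_one).2 fun x => ?_
  have hx0 := hp.1 x
  have hx1 : p x ≤ 1 := by
    rw [← hp.2]; exact Finset.single_le_sum (fun y _ => hp.1 y) (Finset.mem_univ x)
  have h1 : (N x : ℝ) / n ≤ 1 := by
    rw [div_le_one hn']
    have : N x ≤ ∑ y, N y := Finset.single_le_sum (fun _ _ => Nat.zero_le _) (Finset.mem_univ x)
    rw [sum_of_mem_tables hN] at this
    exact_mod_cast this
  have h0 : 0 ≤ (N x : ℝ) / n := by positivity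
  rw [Real.norm_eq_abs, deviation, abs_le]
  constructor <;> linarith

lemma expectation_norm_deviation_sq_le {p : Cell r c → ℝ} (hp : p ∈ stdSimplex ℝ (Cell r c))
    {n : ℕ} (hn : 0 < n) : expectation p n (fun N => ‖deviation p n N‖ ^ 2) ≤ 1 / n := by
  calc _ ≤ expectation p n (fun N => ∑ x, deviation p n N x * deviation p n N x) := by
        refine expectation_mono hp.1 fun N _ => ?_
        have h0 : 0 ≤ ∑ x, deviation p n N x * deviation p n N x :=
          Finset.sum_nonneg fun x _ => mul_self_nonneg _
        rw [← Real.le_sqrt (norm_nonneg _) h0, pi_norm_le_iff_of_nonneg (Real.sqrt_nonneg _)]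
        intro x
        rw [Real.norm_eq_abs]
        refine Real.abs_le_sqrt ?_
        rw [sq]
        exact Finset.single_le_sum (f := fun x => deviation p n N x * deviation p n N x)
          (fun y _ => mul_self_nonneg _) (Finset.mem_univ x)
    _ = (∑ x, covMat p x x) / n := by
        simp only [expectation_sum, expectation_deviation_mul hp hn, Finset.sum_div]
    _ ≤ _ := by
        gcongr
        rw [← hp.2]
        refine Finset.sum_le_sum fun x _ => ?_
        simp only [covMat, Matrix.sub_apply, Matrix.diagonal_apply_eq, Matrix.vecMulVec_apply]
        linarith [mul_self_nonneg (p x)]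

/-- The posterior mean shrinks the sample proportions towards the uniform distribution. -/
lemma posteriorMean_eq {α : ℝ} {n : ℕ} (hn : 0 < n) (hα : (n : ℝ) + (r : ℝ) * c * α ≠ 0)
    (p : Cell r c → ℝ) (N : Cell r c → ℕ) :
    posteriorMean α n N = p + (deviation p n N - (α / ((n : ℝ) + (r : ℝ) * c * α)) •
      (((r : ℝ) * c) • deviation p n N + shift p)) := by
  have hn' : (n : ℝ) ≠ 0 := by positivity
  ext x
  simp only [posteriorMean, deviation, shift, Pi.add_apply, Pi.sub_apply, Pi.smul_apply,
    smul_eq_mul]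
  obtain ⟨q, hq⟩ : ∃ q, q = (N x : ℝ) / n := ⟨_, rfl⟩
  have hN : (N x : ℝ) = q * n := by rw [hq, div_mul_cancel₀ _ hn']
  have ht := div_mul_cancel₀ α hα
  rw [← hq, hN, div_eq_iff hα]
  generalize α / ((n : ℝ) + (r : ℝ) * c * α) = t at *
  linear_combination ((r : ℝ) * c * q - 1) * ht

lemma tendsto_mul_div_add (α a : ℝ) :
    Tendsto (fun n : ℕ => (n : ℝ) * (α / (n + a))) atTop (𝓝 α) := by
  have := (tendsto_natCast_div_add_atTop a).const_mul α
  rw [mul_one] at this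
  exact this.congr fun n => by ring

lemma tendsto_sq_mul_exp_neg {a : ℝ} (ha : 0 < a) :
    Tendsto (fun n : ℕ => (n : ℝ) ^ 2 * Real.exp (-a * n)) atTop (𝓝 0) := by
  have h1 : Tendsto (fun n : ℕ => a * (n : ℝ)) atTop atTop :=
    tendsto_natCast_atTop_atTop.const_mul_atTop ha
  have h2 := ((Real.tendsto_pow_mul_exp_neg_atTop_nhds_zero 2).comp h1).const_mul (1 / a ^ 2)
  rw [mul_zero] at h2
  refine h2.congr fun n => ?_
  simp only [Function.comp_apply, neg_mul]
  field_simp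

lemma abs_leadingTerm_le {E : Type*} [NormedAddCommGroup E] [NormedSpace ℝ E] (g : E →L[ℝ] ℝ)
    (H : E →L[ℝ] E →L[ℝ] ℝ) (K : ℝ) (d : E) (B : ℝ) : ∃ M, ∀ σ u, |σ| ≤ B → ‖u‖ ≤ 1 →
      |leadingTerm g H K d σ u| ≤ M := by
  refine ⟨2 * |g d| * ‖g‖ + B * |g d| ^ 2 + |g d| * ‖H‖ + 2 * |K| * ‖g‖ ^ 2 +
    2 * (‖g‖ * (‖H‖ * ‖d‖)), fun σ u hσ hu => ?_⟩
  have h1 : |g u| ≤ ‖g‖ := g.unit_le_opNorm u hu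
  have h2 : |H u u| ≤ ‖H‖ := by
    calc _ ≤ ‖H‖ * ‖u‖ * ‖u‖ := H.le_opNorm₂ u u
      _ ≤ ‖H‖ * 1 * 1 := by gcongr
      _ = _ := by ring
  have h3 : |H u d| ≤ ‖H‖ * ‖d‖ := by
    calc _ ≤ ‖H‖ * ‖u‖ * ‖d‖ := H.le_opNorm₂ u d
      _ ≤ ‖H‖ * 1 * ‖d‖ := by gcongr
      _ = _ := by ring
  rw [leadingTerm]
  calc _ ≤ |2 * g d * g u| + |σ * g d ^ 2| + |g d * H u u| + |2 * K * g u ^ 2| +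
        |2 * (g u * H u d)| := by
        refine (abs_add_le _ _).trans (add_le_add_left ?_ _)
        refine (abs_add_le _ _).trans (add_le_add_left ?_ _)
        refine (abs_add_le _ _).trans (add_le_add_left ?_ _)
        exact abs_sub _ _
    _ ≤ _ := by
        simp only [abs_mul, abs_two, abs_pow]
        gcongr

/-! ### Limit of the rescaled MSE differences -/

set_option maxHeartbeats 1000000 in
/-- The difference of the mean squared errors of two Dirichlet parameters, to second order. -/
theorem tendsto_sq_mul_mse_sub {f : (Cell r c → ℝ) → ℝ} {p : Cell r c → ℝ}
    (hp : p ∈ stdSimplex ℝ (Cell r c)) (hf : ∀ᶠ x in 𝓝 p, DifferentiableAt ℝ f x)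
    (hf' : DifferentiableAt ℝ (fderiv ℝ f) p) {α β : ℝ} (hα : SubexponentialAlong f α)
    (hβ : SubexponentialAlong f β) :
    Tendsto (fun n : ℕ => (n : ℝ) ^ 2 * (mse f p n α - mse f p n β)) atTop
      (𝓝 (A1 f p * (α ^ 2 - β ^ 2) - 2 * A2 f p * (α - β))) := by
  set K : ℝ := (r : ℝ) * c with hK
  set w : ℝ → ℕ → ℝ := fun γ n => γ / ((n : ℝ) + K * γ) with hw
  have hwt (γ : ℝ) : Tendsto (fun n : ℕ => (n : ℝ) * w γ n) atTop (𝓝 γ) :=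
    tendsto_mul_div_add γ (K * γ)
  set Δ : ℕ → ℝ := fun n => w α n - w β n with hΔ
  set σ : ℕ → ℝ := fun n => w α n + w β n with hσ
  have hΔt : Tendsto (fun n : ℕ => (n : ℝ) * Δ n) atTop (𝓝 (α - β)) :=
    ((hwt α).sub (hwt β)).congr fun n => by simp only [hΔ]; ring
  have hσt : Tendsto (fun n : ℕ => (n : ℝ) * σ n) atTop (𝓝 (α + β)) :=
    ((hwt α).add (hwt β)).congr fun n => by simp only [hσ]; ring
  have hmain : Tendsto (fun n : ℕ => (n : ℝ) * Δ n * ((n : ℝ) * σ n * A1 f p - 2 * A2 f p)) atTop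
      (𝓝 (A1 f p * (α ^ 2 - β ^ 2) - 2 * A2 f p * (α - β))) := by
    convert hΔt.mul ((hσt.mul_const (A1 f p)).sub_const (2 * A2 f p)) using 2
    ring
  suffices herr : Tendsto (fun n : ℕ => (n : ℝ) ^ 2 *
      (mse f p n α - mse f p n β + Δ n * (2 * A2 f p / n - σ n * A1 f p))) atTop (𝓝 0) by
    have := hmain.add herr
    rw [add_zero] at this
    refine this.congr' ?_
    filter_upwards [eventually_gt_atTop 0] with n hn
    have hn' : (n : ℝ) ≠ 0 := by positivity
    field_simp
    ring
  rw [Metric.tendsto_atTop']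
  intro ε hε
  -- The local error is at most `n² ε₁ |Δ| (2 / n)`, eventually at most `2 ε₁ (|α - β| + 1) = ε /
  -- 2`.
  set ε₁ := ε / (4 * (|α - β| + 1))
  have hε₁ : 0 < ε₁ := by positivity
  set B := |α| + |β| + 1 with hB
  have hB0 : 0 < B := by positivity
  obtain ⟨δ, hδ, hloc⟩ := exists_abs_sq_sub_sq_add_le hf hf'.hasFDerivAt K (shift p) B hε₁
  obtain ⟨T, a, ha, htail⟩ := exists_tail_bound hp hδ
  obtain ⟨M, hM⟩ := abs_leadingTerm_le (fderiv ℝ f p) (fderiv ℝ (fderiv ℝ f) p) K (shift p) (2 * B)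
  have hM0 : 0 ≤ M := (abs_nonneg _).trans (hM 0 0 (by simp; positivity) (by simp))
  -- Tail bound: two squared errors, plus `|Δ| ≤ 2 B` times `|leadingTerm| ≤ M`.
  set D := 2 * (1 + |f p|) ^ 2 + 2 * B * M with hD
  have hD0 : 0 ≤ D := by positivity
  have hwB {γ : ℝ} (hγ : |γ| < B) : ∀ᶠ n : ℕ in atTop, |(n : ℝ) * w γ n| < B :=
    (hwt γ).abs.eventually_lt_const hγ
  -- Parameters may be negative, so the denominator is positive only for large `n`.
  have hden (γ : ℝ) : ∀ᶠ n : ℕ in atTop, 0 < (n : ℝ) + K * γ :=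
    (tendsto_atTop_add_const_right _ _ tendsto_natCast_atTop_atTop).eventually_gt_atTop 0
  have hδn : ∀ᶠ n : ℕ in atTop, 1 / (n : ℝ) < δ :=
    tendsto_one_div_atTop_nhds_zero_nat.eventually_lt_const hδ
  have hΔn : ∀ᶠ n : ℕ in atTop, |(n : ℝ) * Δ n| < |α - β| + 1 :=
    hΔt.abs.eventually_lt_const (by linarith)
  have hexp : ∀ᶠ n : ℕ in atTop, D * T * ((n : ℝ) ^ 2 * Real.exp (-(a / 2) * n)) < ε / 2 := by
    have := (tendsto_sq_mul_exp_neg (half_pos ha)).const_mul (D * T)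
    rw [mul_zero] at this
    exact this.eventually_lt_const (half_pos hε)
  -- Growth rate `a / 4` for `f` becomes `a / 2` after squaring; against the tail `exp (-a n)` this
  -- leaves `exp (-(a / 2) n)`.
  have hev := (eventually_gt_atTop 0).and ((hwB (γ := α) (by rw [hB]; linarith [abs_nonneg β])).and
    ((hwB (γ := β) (by rw [hB]; linarith [abs_nonneg α])).and ((hden α).and ((hden β).and
    (hδn.and (hΔn.and (hexp.and ((hα (a / 4) (by positivity)).and
    (hβ (a / 4) (by positivity))))))))))
  obtain ⟨n₀, hn₀⟩ := eventually_atTop.1 hev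
  refine ⟨n₀, fun n hn => ?_⟩
  obtain ⟨hn0, hwα, hwβ, hdα, hdβ, hnδ, hnΔ, hnexp, hnα, hnβ⟩ := hn₀ n hn.le
  clear hn₀ hev
  have hn' : (0 : ℝ) < n := by positivity
  have hn1 : (1 : ℝ) ≤ n := by exact_mod_cast hn0
  have hwn {γ : ℝ} (hγ : |(n : ℝ) * w γ n| < B) : |w γ n| ≤ B * (1 / n) := by
    rw [abs_mul, abs_of_pos hn'] at hγ
    rw [mul_one_div, le_div_iff₀ hn']
    linarith
  have hwn1 {γ : ℝ} (hγ : |(n : ℝ) * w γ n| < B) : |w γ n| ≤ B :=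
    (hwn hγ).trans (mul_le_of_le_one_right hB0.le (by rw [div_le_one hn']; exact hn1))
  have hΔB : |Δ n| ≤ 2 * B :=
    (abs_sub _ _).trans (by linarith [hwn1 hwα, hwn1 hwβ])
  have hσB : |σ n| ≤ 2 * B :=
    (abs_add_le _ _).trans (by linarith [hwn1 hwα, hwn1 hwβ])
  set m : (Cell r c → ℕ) → ℝ := fun N => leadingTerm (fderiv ℝ f p) (fderiv ℝ (fderiv ℝ f) p) K
    (shift p) (σ n) (deviation p n N) with hm
  have hEm : expectation p n m = 2 * A2 f p / n - σ n * A1 f p :=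
    expectation_leadingTerm hp hf hf' hn0 (σ n)
  have hsq {y : ℝ} (hy : |y| ≤ Real.exp (a / 4 * n)) :
      |(y - f p) ^ 2| ≤ (1 + |f p|) ^ 2 * Real.exp (a / 2 * n) := by
    have h1 : 1 ≤ Real.exp (a / 4 * n) := Real.one_le_exp (by positivity)
    have h2 : |y - f p| ≤ (1 + |f p|) * Real.exp (a / 4 * n) := by
      refine (abs_sub _ _).trans ?_
      nlinarith [abs_nonneg (f p)]
    have h3 : Real.exp (a / 2 * n) = Real.exp (a / 4 * n) ^ 2 := by
      rw [← Real.exp_nat_mul]; congr 1; push_cast; ring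
    rw [abs_pow, h3, ← mul_pow]
    gcongr
  have hpt : ∀ N ∈ tables r c n,
      |(f (posteriorMean α n N) - f p) ^ 2 - (f (posteriorMean β n N) - f p) ^ 2 + Δ n * m N| ≤
        ε₁ * |Δ n| * (‖deviation p n N‖ ^ 2 + 1 / n) +
        D * Real.exp (a / 2 * n) * (if ‖deviation p n N‖ < δ then 0 else 1) := by
    intro N hN
    split_ifs with h
    · rw [mul_zero, add_zero, posteriorMean_eq hn0 hdα.ne' p N, posteriorMean_eq hn0 hdβ.ne' p N]
      exact hloc _ (1 / n) (w α n) (w β n) h (by positivity) hnδ (hwn hwα) (hwn hwβ)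
    · have h1 := hsq (hnα N hN)
      have h2 := hsq (hnβ N hN)
      have h3 := abs_mul_le_of_le hΔB (hM (σ n) _ hσB (norm_deviation_le_one hp hn0 hN))
      have h4 : 1 ≤ Real.exp (a / 2 * n) := Real.one_le_exp (by positivity)
      have h5 : 2 * B * M ≤ 2 * B * M * Real.exp (a / 2 * n) :=
        le_mul_of_one_le_right (by positivity) h4
      have h6 : 0 ≤ ε₁ * |Δ n| * (‖deviation p n N‖ ^ 2 + 1 / n) := by positivity
      calc _ ≤ |(f (posteriorMean α n N) - f p) ^ 2| + |(f (posteriorMean β n N) - f p) ^ 2| +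
            |Δ n * m N| := (abs_add_le _ _).trans (add_le_add_left (abs_sub _ _) _)
        _ ≤ (1 + |f p|) ^ 2 * Real.exp (a / 2 * n) + (1 + |f p|) ^ 2 * Real.exp (a / 2 * n) +
            2 * B * M * Real.exp (a / 2 * n) := add_le_add (add_le_add h1 h2) (h3.trans h5)
        _ = D * Real.exp (a / 2 * n) * 1 := by rw [hD]; ring
        _ ≤ _ := by linarith
  have hE : |mse f p n α - mse f p n β + Δ n * (2 * A2 f p / n - σ n * A1 f p)| ≤
      ε₁ * |Δ n| * (1 / n + 1 / n) + D * Real.exp (a / 2 * n) * (T * Real.exp (-a * n)) := by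
    rw [← hEm, mse, mse, ← expectation_sub, ← expectation_const_mul, ← expectation_add]
    refine (abs_expectation_le hp.1 _).trans ((expectation_mono hp.1 hpt).trans ?_)
    rw [expectation_add, expectation_const_mul, expectation_const_mul, expectation_add,
      expectation_const hp]
    have := expectation_norm_deviation_sq_le hp hn0
    have := htail n hn0
    gcongr
  rw [dist_zero_right, Real.norm_eq_abs, abs_mul, abs_of_pos (by positivity : (0 : ℝ) < (n : ℝ) ^ 2)]
  have hexp2 : Real.exp (a / 2 * n) * Real.exp (-a * n) = Real.exp (-(a / 2) * n) := by
    rw [← Real.exp_add]; congr 1; ring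
  calc _ ≤ (n : ℝ) ^ 2 * (ε₁ * |Δ n| * (1 / n + 1 / n) +
        D * Real.exp (a / 2 * n) * (T * Real.exp (-a * n))) := by gcongr
    _ = 2 * ε₁ * |n * Δ n| + D * T * ((n : ℝ) ^ 2 * Real.exp (-(a / 2) * n)) := by
        rw [← hexp2, abs_mul, abs_of_pos hn']
        field_simp
        ring
    _ ≤ 2 * ε₁ * (|α - β| + 1) + D * T * ((n : ℝ) ^ 2 * Real.exp (-(a / 2) * n)) := by gcongr
    _ = ε / 2 + D * T * ((n : ℝ) ^ 2 * Real.exp (-(a / 2) * n)) := by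
        congr 1
        simp only [ε₁]
        field_simp
        ring
    _ < ε := by linarith

end ContingencyTable

end

/-! ### Minimising the limiting quadratic -/

theorem theorem2 {r c : ℕ} (f : (ContingencyTable.Cell r c → ℝ) → ℝ)
    (p : ContingencyTable.Cell r c → ℝ) (hp : p ∈ stdSimplex ℝ (ContingencyTable.Cell r c))
    (hf : ContingencyTable.TimesDifferentiableAt 4 f p)
    (S : Set ℝ) (hS : ∀ α ∈ S, ContingencyTable.SubexponentialAlong f α)
    (hA : 0 < ContingencyTable.A1 f p)
    (hmem : ContingencyTable.A2 f p / ContingencyTable.A1 f p ∈ S) :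
    (∃ C : ℕ → ℝ, ContingencyTable.IsRescaledLimit f p S C
      (fun α => ContingencyTable.A1 f p * α ^ 2 - 2 * ContingencyTable.A2 f p * α)) ∧
    (∀ (C : ℕ → ℝ) (L : ℝ → ℝ), ContingencyTable.IsRescaledLimit f p S C L →
      {α : ℝ | α ∈ S ∧ IsMinOn L S α} =
        {ContingencyTable.A2 f p / ContingencyTable.A1 f p}) ∧
    (∀ α ∈ S, α ≠ ContingencyTable.A2 f p / ContingencyTable.A1 f p →
      ∀ᶠ n : ℕ in atTop,
        ContingencyTable.mse f p n (ContingencyTable.A2 f p / ContingencyTable.A1 f p) <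
          ContingencyTable.mse f p n α) := by
  have hlim {α β : ℝ} (hα : α ∈ S) (hβ : β ∈ S) := ContingencyTable.tendsto_sq_mul_mse_sub hp
    (hf.eventually_differentiableAt (by norm_num)) (hf.differentiableAt_fderiv (by norm_num))
    (hS α hα) (hS β hβ)
  set α₀ := ContingencyTable.A2 f p / ContingencyTable.A1 f p with hα₀
  set a₁ := ContingencyTable.A1 f p
  have hA2 : ContingencyTable.A2 f p = a₁ * α₀ := by rw [hα₀, mul_div_cancel₀ _ hA.ne']
  rw [hA2] at hlim ⊢
  have hquad (α : ℝ) : a₁ * (α ^ 2 - α₀ ^ 2) - 2 * (a₁ * α₀) * (α - α₀) = a₁ * (α - α₀) ^ 2 := by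
    ring
  -- Centring at the MSE of `α₀` gives the limit up to the quadratic's value at `α₀`, which the `1 /
  -- n²` correction restores.
  refine ⟨⟨fun n => ContingencyTable.mse f p n α₀ -
    (a₁ * α₀ ^ 2 - 2 * (a₁ * α₀) * α₀) / (n : ℝ) ^ 2, fun α hα => ?_⟩, fun C L hL => ?_,
    fun α hα hne => ?_⟩
  · have h := (hlim hα hmem).add_const (a₁ * α₀ ^ 2 - 2 * (a₁ * α₀) * α₀)
    have e : a₁ * (α ^ 2 - α₀ ^ 2) - 2 * (a₁ * α₀) * (α - α₀) +
        (a₁ * α₀ ^ 2 - 2 * (a₁ * α₀) * α₀) = a₁ * α ^ 2 - 2 * (a₁ * α₀) * α := by ring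
    rw [e] at h
    refine h.congr' ?_
    filter_upwards [eventually_gt_atTop 0] with n hn
    have hn' : (n : ℝ) ≠ 0 := by positivity
    field_simp
    ring
  · have hdiff {α : ℝ} (hα : α ∈ S) : L α - L α₀ = a₁ * (α - α₀) ^ 2 := by
      rw [← hquad]
      refine tendsto_nhds_unique (((hL α hα).sub (hL α₀ hmem)).congr fun n => ?_) (hlim hα hmem)
      ring
    ext α
    simp only [Set.mem_ofPred_eq, Set.mem_singleton_iff]
    constructor
    · rintro ⟨hα, hmin⟩
      have h1 : L α ≤ L α₀ := hmin hmem
      have h2 := hdiff hα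
      by_contra hne
      have h3 : 0 < a₁ * (α - α₀) ^ 2 := mul_pos hA (sq_pos_of_ne_zero (sub_ne_zero.2 hne))
      linarith
    · intro h
      rw [h]
      refine ⟨hmem, fun β hβ => ?_⟩
      have h1 := hdiff hβ
      have h2 : 0 ≤ a₁ * (β - α₀) ^ 2 := by positivity
      show L α₀ ≤ L β
      linarith
  · have h := hlim hα hmem
    rw [hquad] at h
    have h3 : 0 < a₁ * (α - α₀) ^ 2 := mul_pos hA (sq_pos_of_ne_zero (sub_ne_zero.2 hne))
    filter_upwards [h.eventually_const_lt h3] with n hn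
    exact sub_pos.1 (pos_of_mul_pos_right hn (sq_nonneg _))
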